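/- A hypergraph $G$ consists of a finite set $V(G)$ of vertices, a finite set $E(G)$ of edges, and an incidence function $f_G \colon E(G) \to \mathcal{P}(V(G)) \setminus \{\emptyset\}$; in particular, parallel edges are allowed. Its incidence graph is the bipartite graph on $V(G) \mathbin{\dot\cup} E(G)$ in which $v \in V(G)$ and $e \in E(G)$ are adjacent if and only if $v \in f_G(e)$. The hypergraph $G$ is called connected, respectively Berge-acyclic, if its incidence graph is connected, respectively acyclic. Let $\mathcal{BA}$ denote the class of all connected Berge-acyclic hypergraphs. For hypergraphs $F$ and $G$, a homomorphism (respectively, an incidence homomorphism) from $F$ to $G$ is a pair $(h_V, h_E)$ of maps $h_V \colon V(F) \to V(G)$ and $h_E \colon E(F) \to E(G)$ such that $h_V(f_F(e)) = f_G(h_E(e))$ (respectively, $h_V(f_F(e)) \subseteq f_G(h_E(e))$) for every $e \in E(F)$. Let $\mathsf{Hom}(F,G)$ and $\mathsf{InHom}(F,G)$ denote the numbers of homomorphisms and of incidence homomorphisms from $F$ to $G$, respectively. **Lemma.** For all hypergraphs $G$ and $H$, the following are equivalent: 1. $\mathsf{InHom}(B,G) = \mathsf{InHom}(B,H)$ for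 every $B \in \mathcal{BA}$. 2. $\mathsf{Hom}(B,G) = \mathsf{Hom}(B,H)$ for every $B \in \mathcal{BA}$. -/

import Mathlib

universe u v w

/-- A finite hypergraph, possibly with parallel edges: a finite type of vertices, a finite type of
edges, and an incidence function assigning to every edge a non-empty set of vertices. -/
structure MultiHypergraph where
  /-- The vertices. -/
  V : Type u
  /-- The edges. -/
  E : Type u
  [finite_V : Finite V]
  [finite_E : Finite E]
  /-- The incidence function. -/
  inc : E → Set V
  inc_nonempty : ∀ e, (inc e).Nonempty

namespace MultiHypergraph

attribute [instance] finite_V finite_E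

/-- The incidence graph: the bipartite simple graph on the disjoint union of vertices and edges
in which a vertex `v` and an edge `e` are adjacent if and only if `v` lies in `e`. -/
def incidenceGraph (G : MultiHypergraph.{u}) : SimpleGraph (G.V ⊕ G.E) where
  Adj
    | .inl x, .inr e => x ∈ G.inc e
    | .inr e, .inl x => x ∈ G.inc e
    | .inl _, .inl _ => False
    | .inr _, .inr _ => False
  symm := ⟨by
    rintro (x | e) (y | f) h <;> exact h⟩
  loopless := ⟨by
    rintro (x | e) h <;> exact h⟩

/-- A hypergraph is connected if its incidence graph is (in particular it is not empty). -/
def IsConnected (G : MultiHypergraph.{u}) : Prop := G.incidenceGraph.Connected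

/-- A hypergraph is Berge-acyclic if its incidence graph is acyclic. -/
def IsBergeAcyclic (G : MultiHypergraph.{u}) : Prop := G.incidenceGraph.IsAcyclic

/-- The class of all connected Berge-acyclic hypergraphs. -/
def connectedBergeAcyclic : Set MultiHypergraph.{u} := {B | B.IsConnected ∧ B.IsBergeAcyclic}

/-- A pair of maps is a homomorphism if every edge is mapped onto the full image edge. -/
def IsHom (F : MultiHypergraph.{u}) (G : MultiHypergraph.{v})
    (h : (F.V → G.V) × (F.E → G.E)) : Prop :=
  ∀ e : F.E, h.1 '' F.inc e = G.inc (h.2 e)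

/-- A pair of maps is an incidence homomorphism if every edge is mapped into the image edge. -/
def IsIncHom (F : MultiHypergraph.{u}) (G : MultiHypergraph.{v})
    (h : (F.V → G.V) × (F.E → G.E)) : Prop :=
  ∀ e : F.E, h.1 '' F.inc e ⊆ G.inc (h.2 e)

/-- The number of homomorphisms from `F` to `G`. -/
noncomputable def homCount (F : MultiHypergraph.{u}) (G : MultiHypergraph.{v}) : ℕ :=
  Nat.card {h : (F.V → G.V) × (F.E → G.E) // IsHom F G h}

/-- The number of incidence homomorphisms from `F` to `G`. -/
noncomputable def incHomCount (F : MultiHypergraph.{u}) (G : MultiHypergraph.{v}) : ℕ :=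
  Nat.card {h : (F.V → G.V) × (F.E → G.E) // IsIncHom F G h}

/-- The homomorphism vector of `G` restricted to a class of hypergraphs. -/
noncomputable def homVector (C : Set MultiHypergraph.{u}) (G : MultiHypergraph.{v}) : C → ℕ :=
  fun B => homCount B.1 G

/-- The incidence homomorphism vector of `G` restricted to a class of hypergraphs. -/
noncomputable def incHomVector (C : Set MultiHypergraph.{u}) (G : MultiHypergraph.{v}) : C → ℕ :=
  fun B => incHomCount B.1 G

end MultiHypergraph

/-! Put the edges of `G` and `H` on the disjoint union X of their vertex sets. Let `b = true` stand
for homomorphisms and `b = false` for incidence homomorphisms. In a weighted count, a pendant edge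
at v whose other vertices carry the weights `g i` may be deleted if the weight at v is multiplied by
`edgeOp b J g` (`wcount_attach`). Thus all connected Berge-acyclic counts of type `b` agree exactly
when every function in the algebra generated from 1 by these operators has the same sum over `G.V`
as over `H.V`.

The heart is that a subalgebra of X → ℚ closed under the operators of one type is closed under those
of the other (`EdgeClosed.swap`). A subalgebra on a finite set consists of all functions constant on
its classes of inseparable points. Closure of either type means that these classes are equitable:
the number of edges at x with a given profile depends only on the class of x. For `false` the
operators are sums of products, from which interpolation isolates each profile. For `true` one
inducts on edge size, since k points cover an edge of size at least k only if they are distinct. -/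

/-! ### Subalgebras over finite sets, and colour-preserving bijections -/

open scoped Classical in
/-- A function on a finite type that is constant on the classes of points which a subalgebra does
not separate lies in that subalgebra. -/
theorem Subalgebra.mem_of_forall_eq {X : Type*} [Fintype X] (A : Subalgebra ℚ (X → ℚ))
    {f : X → ℚ} (hf : ∀ x y, (∀ a ∈ A, a x = a y) → f x = f y) : f ∈ A := by
  have ind : ∀ x, (fun y => if ∀ a ∈ A, a x = a y then (1 : ℚ) else 0) ∈ A := by
    intro x
    -- Interpolation: the product over all y of these normalised separators is the indicator of the
    -- class of x.
    have key : ∀ y, ∃ a ∈ A, a x = 1 ∧ ((¬ ∀ a ∈ A, a x = a y) → a y = 0) := by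
      intro y
      by_cases h : ∀ a ∈ A, a x = a y
      · exact ⟨1, A.one_mem, rfl, fun h' => absurd h h'⟩
      · push Not at h
        obtain ⟨a, ha, hxy⟩ := h
        refine ⟨(a x - a y)⁻¹ • (a - algebraMap ℚ (X → ℚ) (a y)),
          A.smul_mem (A.sub_mem ha (A.algebraMap_mem _)) _, ?_, fun _ => ?_⟩
        · simp [inv_mul_cancel₀ (sub_ne_zero.2 hxy)]
        · simp
    choose a ha hax hay using key
    have : (fun y => if ∀ a ∈ A, a x = a y then (1 : ℚ) else 0) = ∏ z, a z := by
      funext y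
      rw [Finset.prod_apply]
      split_ifs with h
      · exact (Finset.prod_eq_one fun z _ => by rw [← h _ (ha z), hax]).symm
      · exact (Finset.prod_eq_zero (f := fun c => a c y) (Finset.mem_univ y) (hay y h)).symm
    rw [this]
    exact A.prod_mem fun z _ => ha z
  -- Each class indicator occurs once per point of the class, hence the division by the class size.
  have : f = ∑ x, (f x * (∑ y, if ∀ a ∈ A, a x = a y then (1 : ℚ) else 0)⁻¹) •
      (fun y => if ∀ a ∈ A, a x = a y then (1 : ℚ) else 0) := by
    funext z
    simp only [Finset.sum_apply, Pi.smul_apply, smul_eq_mul, mul_ite, mul_one, mul_zero]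
    have e : ∀ x, (if ∀ a ∈ A, a x = a z then
        f x * (∑ y, if ∀ a ∈ A, a x = a y then (1 : ℚ) else 0)⁻¹ else 0) =
        f z * (∑ y, if ∀ a ∈ A, a z = a y then (1 : ℚ) else 0)⁻¹ *
          (if ∀ a ∈ A, a z = a x then (1 : ℚ) else 0) := by
      intro x
      have hs : (∀ a ∈ A, a x = a z) ↔ ∀ a ∈ A, a z = a x :=
        forall₂_congr fun a _ => eq_comm
      by_cases h : ∀ a ∈ A, a x = a z
      · rw [if_pos h, if_pos (hs.1 h), hf x z h, mul_one]
        congr 3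
        funext y
        congr 1
        exact propext (forall₂_congr fun a ha => by rw [h a ha])
      · rw [if_neg h, if_neg (mt hs.2 h), mul_zero]
    rw [Finset.sum_congr rfl fun x _ => e x, ← Finset.mul_sum, mul_assoc, inv_mul_cancel₀, mul_one]
    refine (lt_of_lt_of_le one_pos ?_).ne'
    refine le_trans ?_ (Finset.single_le_sum (fun i _ => ?_) (Finset.mem_univ z))
    · simp
    · split_ifs <;> simp
  rw [this]
  exact A.sum_mem fun x _ => A.smul_mem (ind x) _

/-- Two weighted sums agree if there are equally many terms of each colour on both sides and terms
of the same colour have the same value. -/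
theorem Finset.sum_eq_sum_of_card_fiber_eq {F γ : Type*} [DecidableEq γ] (φ : F → γ)
    (s t : Finset F) (p q : F → ℚ)
    (hcard : ∀ c, (s.filter (φ · = c)).card = (t.filter (φ · = c)).card)
    (hpq : ∀ a ∈ s, ∀ b ∈ t, φ a = φ b → p a = q b) : ∑ a ∈ s, p a = ∑ b ∈ t, q b := by
  have fib : ∀ c, Nonempty ({a : s // φ a = c} ≃ {b : t // φ b = c}) := by
    intro c
    refine Fintype.card_eq.1 ?_
    have := hcard c
    rw [← Fintype.card_coe, ← Fintype.card_coe] at this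
    refine Eq.trans (Fintype.card_congr ?_) (this.trans (Fintype.card_congr ?_))
    · exact (Equiv.subtypeSubtypeEquivSubtypeInter (· ∈ s) (φ · = c)).trans
        (Equiv.subtypeEquivRight (by simp))
    · exact ((Equiv.subtypeSubtypeEquivSubtypeInter (· ∈ t) (φ · = c)).trans
        (Equiv.subtypeEquivRight (by simp))).symm
  let e : s ≃ t := Equiv.ofFiberEquiv (f := fun a : s => φ a) (g := fun b : t => φ b)
    fun c => (fib c).some
  rw [← Finset.sum_coe_sort s, ← Finset.sum_coe_sort t]
  refine Fintype.sum_equiv e _ _ fun a => hpq _ a.2 _ (e a).2 ?_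
  exact (Equiv.ofFiberEquiv_map (f := fun a : s => φ a) (g := fun b : t => φ b)
    (fun c => (fib c).some) a).symm

/-- If two finite sets contain equally many elements of each colour, a permutation maps the one
onto the other, respecting colours on the first and sending a given point to a given point of the
same colour. -/
theorem Set.exists_perm_image_eq {X γ : Type*} [Finite X] (c : X → γ) {s t : Set X}
    (hcard : ∀ a, {z ∈ s | c z = a}.ncard = {z ∈ t | c z = a}.ncard) {x y : X} (hx : x ∈ s)
    (hy : y ∈ t) (hxy : c x = c y) :
    ∃ σ : Equiv.Perm X, σ x = y ∧ σ '' s = t ∧ ∀ z ∈ s, c (σ z) = c z := by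
  classical
  have fib : ∀ a, Nonempty ({z : s // c z = a} ≃ {z : t // c z = a}) := by
    intro a
    refine Finite.card_eq.1 ?_
    refine Eq.trans (Nat.card_congr ?_) ((hcard a).trans (Nat.card_congr ?_))
    · exact Equiv.subtypeSubtypeEquivSubtypeInter (· ∈ s) (c · = a)
    · exact (Equiv.subtypeSubtypeEquivSubtypeInter (· ∈ t) (c · = a)).symm
  let e : s ≃ t := Equiv.ofFiberEquiv (f := fun a : s => c a) (g := fun b : t => c b)
    fun a => (fib a).some
  have he : ∀ z, c (e z) = c z := Equiv.ofFiberEquiv_map (f := fun a : s => c a)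
    (g := fun b : t => c b) (fun a => (fib a).some)
  -- The swap corrects the image of x to y; it preserves colours because `e x`, x and y share one.
  let e' : s ≃ t := e.trans (Equiv.swap (e ⟨x, hx⟩) ⟨y, hy⟩)
  have he' : ∀ z, c (e' z) = c z := by
    intro z
    simp only [e', Equiv.trans_apply, Equiv.swap_apply_def]
    split_ifs with h1 h2
    · obtain rfl := e.injective h1
      exact hxy.symm
    · rw [he, ← he z, h2]; exact hxy
    · exact he z
  have := Fintype.ofFinite X
  refine ⟨Equiv.extendSubtype (p := (· ∈ s)) (q := (· ∈ t)) e', ?_, ?_, ?_⟩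
  · rw [Equiv.extendSubtype_apply_of_mem (p := (· ∈ s)) (q := (· ∈ t)) e' x hx]
    simp [e']
  · ext z
    constructor
    · rintro ⟨a, ha, rfl⟩
      exact Equiv.extendSubtype_mem (p := (· ∈ s)) (q := (· ∈ t)) e' a ha
    · intro hz
      refine ⟨e'.symm ⟨z, hz⟩, (e'.symm ⟨z, hz⟩).2, ?_⟩
      rw [Equiv.extendSubtype_apply_of_mem (p := (· ∈ s)) (q := (· ∈ t)) e' _ (e'.symm ⟨z, hz⟩).2]
      simp
  · intro z hz
    rw [Equiv.extendSubtype_apply_of_mem (p := (· ∈ s)) (q := (· ∈ t)) e' z hz]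
    exact he' ⟨z, hz⟩

/-! ### Transfer operators and equitable partitions -/

namespace MultiHypergraph

/-- `Cov b s t` says that `s` is contained in `t`, and that `s` is all of `t` if `b = true`. -/
def Cov (b : Bool) {X : Type*} (s t : Set X) : Prop := s ⊆ t ∧ (b = true → t ⊆ s)

theorem cov_image_iff (b : Bool) {X Y : Type*} {i : X → Y} (hi : Function.Injective i)
    (s t : Set X) : Cov b (i '' s) (i '' t) ↔ Cov b s t := by
  simp [Cov, Set.image_subset_image_iff hi]

open scoped Classical in
/-- The weighted number of maps `u` from `ι` such that `x` together with the range of `u` covers `s`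
(in the sense of `Cov b`); the weight of `u` is the product of the numbers `g i (u i)`. -/
noncomputable def tupleSum (b : Bool) {X ι : Type*} [Fintype X] [Fintype ι] (s : Set X)
    (g : ι → X → ℚ) (x : X) : ℚ :=
  ∑ u : ι → X, if Cov b (insert x (Set.range u)) s then ∏ i, g i (u i) else 0

/-- Sum of `tupleSum` over all edges: the transfer operator of a pendant edge. -/
noncomputable def edgeOp (b : Bool) {X F ι : Type*} [Fintype X] [Fintype F] [Fintype ι]
    (J : F → Set X) (g : ι → X → ℚ) (x : X) : ℚ :=
  ∑ f, tupleSum b (J f) g x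

/-- A subalgebra closed under the transfer operators of pendant edges of all sizes. -/
def EdgeClosed (b : Bool) {X : Type u} {F : Type v} [Fintype X] [Fintype F]
    (J : F → Set X) (A : Subalgebra ℚ (X → ℚ)) : Prop :=
  ∀ (ι : Type w) [Fintype ι] (g : ι → X → ℚ), (∀ i, g i ∈ A) → edgeOp b J g ∈ A

section

variable {X : Type u} {F : Type v} [Fintype X] [Fintype F] {ι : Type w} [Fintype ι]

theorem tupleSum_eq_zero (b : Bool) {s : Set X} (g : ι → X → ℚ) {x : X} (hx : x ∉ s) :
    tupleSum b s g x = 0 :=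
  Finset.sum_eq_zero fun _ _ => if_neg fun h => hx (h.1 (Set.mem_insert _ _))

open scoped Classical in
theorem tupleSum_pos {s : Set X} {g : ι → X → ℚ} {x : X} {u : ι → X}
    (hu : insert x (Set.range u) = s) (hg : ∀ i z, 0 ≤ g i z) (hpos : ∀ i, 0 < g i (u i)) :
    0 < tupleSum true s g x := by
  refine Finset.sum_pos' (fun u' _ => ?_) ⟨u, Finset.mem_univ _, ?_⟩
  · split_ifs
    · exact Finset.prod_nonneg fun i _ => hg i _
    · exact le_rfl
  · rw [if_pos ⟨hu.subset, fun _ => hu.superset⟩]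
    exact Finset.prod_pos fun i _ => hpos i

-- Without the surjectivity condition the entries of a tuple range over `s` independently, so the
-- sum factors.
open scoped Classical in
theorem tupleSum_false {s : Set X} (g : ι → X → ℚ) {x : X} (hx : x ∈ s) :
    tupleSum false s g x = ∏ i, ∑ y, if y ∈ s then g i y else 0 := by
  rw [Finset.prod_univ_sum, Fintype.piFinset_univ]
  refine Finset.sum_congr rfl fun p _ => ?_
  by_cases h : ∀ i, p i ∈ s
  · rw [if_pos, Finset.prod_congr rfl fun i _ => (if_pos (h i)).symm]
    simp only [Cov, Set.insert_subset_iff, hx, true_and, Bool.false_eq_true, false_imp_iff,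
      and_true]
    rintro _ ⟨i, rfl⟩
    exact h i
  · push Not at h
    obtain ⟨i, hi⟩ := h
    rw [if_neg fun h => hi (h.1 (Set.mem_insert_of_mem _ ⟨i, rfl⟩)),
      Finset.prod_eq_zero (Finset.mem_univ i) (if_neg hi)]

theorem tupleSum_perm (b : Bool) {s t : Set X} (g : ι → X → ℚ) (σ : Equiv.Perm X)
    (hst : σ '' s = t) (hg : ∀ i, ∀ z ∈ s, g i (σ z) = g i z) (x : X) :
    tupleSum b s g x = tupleSum b t g (σ x) := by
  classical
  refine Fintype.sum_equiv ((Equiv.refl ι).arrowCongr σ) _ _ fun u => ?_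
  have h1 : insert (σ x) (Set.range (((Equiv.refl ι).arrowCongr σ) u)) =
      σ '' (insert x (Set.range u)) := by
    rw [Set.image_insert_eq, ← Set.range_comp]; rfl
  rw [h1, ← hst]
  simp only [cov_image_iff b σ.injective]
  split_ifs with h
  · refine Finset.prod_congr rfl fun i _ => (hg i _ (h.1 ?_)).symm
    exact Set.mem_insert_of_mem _ ⟨i, rfl⟩
  · rfl

open scoped Classical in
/-- The transfer sum only sees the image of an injective map if the edge lies in it. -/
theorem tupleSum_image (b : Bool) {Y : Type*} [Fintype Y] {i : X → Y} (hi : Function.Injective i)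
    (s : Set X) (g : ι → Y → ℚ) (x : X) :
    tupleSum b (i '' s) g (i x) = tupleSum b s (fun j z => g j (i z)) x := by
  symm
  refine Finset.sum_of_injOn (fun u => i ∘ u) (fun u _ v _ h => ?_) (by simp) ?_ ?_
  · funext j
    exact hi (congrFun h j)
  · intro u _ hu
    refine if_neg fun h => hu ?_
    have : ∀ j, ∃ z, i z = u j := fun j => by
      obtain ⟨z, _, hz⟩ := h.1 (Set.mem_insert_of_mem _ ⟨j, rfl⟩)
      exact ⟨z, hz⟩
    choose z hz using this
    exact ⟨z, by simp, funext hz⟩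
  · intro u _
    have h1 : insert (i x) (Set.range (i ∘ u)) = i '' (insert x (Set.range u)) := by
      rw [Set.image_insert_eq, ← Set.range_comp]
    dsimp only
    rw [h1]
    exact if_congr (cov_image_iff b hi _ _).symm rfl rfl

/-- The set of points which a subalgebra does not separate from a given point. -/
def cls {X : Type*} (A : Subalgebra ℚ (X → ℚ)) (x : X) : Set X := {y | ∀ a ∈ A, a x = a y}

theorem cls_eq_iff {X : Type*} {A : Subalgebra ℚ (X → ℚ)} {x y : X} :
    cls A x = cls A y ↔ ∀ a ∈ A, a x = a y := by
  constructor
  · intro h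
    have : y ∈ cls A x := h ▸ (fun _ _ => rfl : y ∈ cls A y)
    exact this
  · intro h
    ext z
    exact forall₂_congr fun a ha => by rw [h a ha]

theorem mem_of_cls {A : Subalgebra ℚ (X → ℚ)} {f : X → ℚ}
    (hf : ∀ x y, cls A x = cls A y → f x = f y) : f ∈ A :=
  A.mem_of_forall_eq fun x y h => hf x y (cls_eq_iff.2 h)

theorem indicator_cls_mem (A : Subalgebra ℚ (X → ℚ)) (c : Set X) [DecidablePred (cls A · = c)] :
    (fun x => if cls A x = c then (1 : ℚ) else 0) ∈ A :=
  mem_of_cls fun x y h => by simp only [h]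

/-- How many vertices of each class an edge contains. -/
noncomputable def profile {X : Type*} (A : Subalgebra ℚ (X → ℚ)) (s : Set X) (c : Set X) : ℕ :=
  {z ∈ s | cls A z = c}.ncard

/-- Equal profiles give a permutation taking s to t and x to y that preserves classes on s, and
members of `A` cannot distinguish points of one class. -/
theorem tupleSum_eq_of_profile_eq (b : Bool) {A : Subalgebra ℚ (X → ℚ)} {s t : Set X}
    (h : profile A s = profile A t) {x y : X} (hx : x ∈ s) (hy : y ∈ t) (hxy : cls A x = cls A y)
    {g : ι → X → ℚ} (hg : ∀ i, g i ∈ A) : tupleSum b s g x = tupleSum b t g y := by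
  obtain ⟨σ, rfl, hσ, hc⟩ := Set.exists_perm_image_eq (cls A) (congrFun h) hx hy hxy
  exact tupleSum_perm b g σ hσ (fun i z hz => cls_eq_iff.1 (hc z hz) _ (hg i)) x

theorem ncard_eq_of_profile_eq {A : Subalgebra ℚ (X → ℚ)} {s t : Set X}
    (h : profile A s = profile A t) : s.ncard = t.ncard := by
  classical
  have key : ∀ s : Set X, s.ncard = ∑ c, profile A s c := by
    intro s
    rw [Set.ncard_eq_toFinset_card', Finset.card_eq_sum_card_fiberwise (f := cls A)
      (t := Finset.univ) (by simp)]
    refine Finset.sum_congr rfl fun c _ => ?_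
    rw [profile, Set.ncard_eq_toFinset_card']
    congr 1
    ext; simp
  rw [key, key, h]

open scoped Classical in
/-- The classes of `A` form an equitable partition: the number of edges at `x` with a given profile
depends on the class of `x` only. -/
def Equitable (J : F → Set X) (A : Subalgebra ℚ (X → ℚ)) : Prop :=
  ∀ x y, cls A x = cls A y → ∀ p, (Finset.univ.filter fun f => x ∈ J f ∧ profile A (J f) = p).card =
    (Finset.univ.filter fun f => y ∈ J f ∧ profile A (J f) = p).card

/-- Grouping the edges at x by profile, each term depends only on the profile and the class of x,
and so does the number of terms. -/
theorem Equitable.edgeClosed {J : F → Set X} {A : Subalgebra ℚ (X → ℚ)} (h : Equitable J A)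
    (b : Bool) : EdgeClosed.{u, v, w} b J A := by
  classical
  intro ι _ g hg
  refine mem_of_cls fun x y hxy => ?_
  have key : ∀ x, edgeOp b J g x =
      ∑ f ∈ Finset.univ.filter (fun f => x ∈ J f), tupleSum b (J f) g x := fun x =>
    (Finset.sum_filter_of_ne fun f _ hf => by_contra fun hx => hf (tupleSum_eq_zero b g hx)).symm
  rw [key, key]
  refine Finset.sum_eq_sum_of_card_fiber_eq (fun f => profile A (J f)) _ _ _ _ (fun c => ?_) ?_
  · simpa [Finset.filter_filter] using h x y hxy c
  · intro e he f hf hef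
    exact tupleSum_eq_of_profile_eq b hef (by simpa using he) (by simpa using hf) hxy hg

/-- The operators sum, over the edges at x, products of the edge functions `S a`. By linearity any
function in the algebra `B` generated by the `S a` may be summed in this way. `B` contains every
entry of the profile, hence the indicator of each profile. -/
theorem EdgeClosed.equitable_of_false {J : F → Set X} {A : Subalgebra ℚ (X → ℚ)}
    (h : EdgeClosed.{u, v, w} false J A) : Equitable J A := by
  classical
  let S : (X → ℚ) → F → ℚ := fun a f => ∑ y, if y ∈ J f then a y else 0
  let B : Subalgebra ℚ (F → ℚ) := Algebra.adjoin ℚ (S '' A)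
  have hB : ∀ q ∈ B, (fun x => ∑ f, if x ∈ J f then q f else 0) ∈ A := by
    intro q hq
    -- `B` is the linear span of finite products of the `S a`, and each such product comes from one
    -- pendant edge.
    have hq' : q ∈ Submodule.span ℚ (Submonoid.closure (S '' A) : Set (F → ℚ)) := by
      rw [← Algebra.adjoin_eq_span]; exact hq
    clear hq
    induction hq' using Submodule.span_induction with
    | mem q hq =>
      have : ∃ (κ : Type w) (_ : Fintype κ) (g : κ → X → ℚ), (∀ i, g i ∈ A) ∧
          q = ∏ i, S (g i) := by
        induction hq using Submonoid.closure_induction with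
        | mem q hq =>
          obtain ⟨a, ha, rfl⟩ := hq
          exact ⟨PUnit, inferInstance, fun _ => a, fun _ => ha, by simp⟩
        | one => exact ⟨PEmpty, inferInstance, fun i => i.elim, fun i => i.elim, by simp⟩
        | mul p q _ _ hp hq =>
          obtain ⟨κ, _, g, hg, rfl⟩ := hp
          obtain ⟨κ', _, g', hg', rfl⟩ := hq
          exact ⟨κ ⊕ κ', inferInstance, Sum.elim g g', by rintro (i | i) <;> simp [hg, hg'],
            by simp⟩
      obtain ⟨κ, _, g, hg, rfl⟩ := this
      convert h κ g hg using 1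
      funext x
      refine Finset.sum_congr rfl fun f _ => ?_
      split_ifs with hx
      · rw [tupleSum_false g hx, Finset.prod_apply]
      · rw [tupleSum_eq_zero false g hx]
    | zero => convert A.zero_mem using 1; funext x; simp
    | add p q _ _ hp hq =>
      convert A.add_mem hp hq using 1
      funext x
      simp only [Pi.add_apply, ← Finset.sum_add_distrib]
      exact Finset.sum_congr rfl fun f _ => by split_ifs <;> simp
    | smul c q _ hq =>
      convert A.smul_mem hq c using 1
      funext x
      simp [Finset.mul_sum]
  have hS : ∀ e f, (∀ q ∈ B, q e = q f) → profile A (J e) = profile A (J f) := by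
    intro e f hef
    funext c
    have := hef _ (Algebra.subset_adjoin ⟨_, indicator_cls_mem A c, rfl⟩)
    have key : ∀ e, S (fun x => if cls A x = c then (1 : ℚ) else 0) e = profile A (J e) c := by
      intro e
      simp only [S, ← ite_and]
      rw [Finset.sum_boole, profile, Set.ncard_eq_toFinset_card']
      congr 2
      ext; simp
    rw [key, key] at this
    exact_mod_cast this
  intro x y hxy p
  have hp : (fun f => if profile A (J f) = p then (1 : ℚ) else 0) ∈ B :=
    B.mem_of_forall_eq fun e f hef => by simp only [hS e f hef]
  have := cls_eq_iff.1 hxy _ (hB _ hp)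
  simp only [← ite_and, Finset.sum_boole] at this
  exact_mod_cast this

/-- The size bound forces x and the entries of u to be distinct, so the profile can be read off from
their classes. -/
theorem profile_eq_of_insert_range {X : Type*} [Finite X] {A : Subalgebra ℚ (X → ℚ)} {s : Set X} {x : X} {u : ι → X}
    (h : insert x (Set.range u) = s) (hs : Fintype.card ι + 1 ≤ s.ncard) (c : Set X) :
    profile A s c = {o : Option ι | cls A (o.elim x u) = c}.ncard := by
  have hr : Set.range (fun o : Option ι => o.elim x u) = s := by
    rw [← h]
    ext z
    simp only [Set.mem_range, Option.exists, Option.elim_none, Option.elim_some,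
      Set.mem_insert_iff, eq_comm]
  have hinj : Function.Injective (fun o : Option ι => o.elim x u) := by
    classical
    have h1 : (Finset.univ.image (fun o : Option ι => o.elim x u)).card =
        (Finset.univ : Finset (Option ι)).card := by
      refine le_antisymm Finset.card_image_le ?_
      rw [Finset.card_univ, Fintype.card_option]
      refine hs.trans_eq ?_
      have := Fintype.ofFinite X
      rw [← hr, Set.ncard_eq_toFinset_card']
      congr 1
      ext; simp
    have := Finset.card_image_iff.1 h1
    simpa using this
  rw [profile, ← Set.ncard_image_of_injective _ hinj, ← hr]
  congr 1
  ext z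
  constructor
  · rintro ⟨⟨o, rfl⟩, ho⟩
    exact ⟨o, ho, rfl⟩
  · rintro ⟨o, ho, rfl⟩
    exact ⟨⟨o, rfl⟩, ho⟩

end

end MultiHypergraph

/-! ### Equitability from the homomorphism operators -/

namespace MultiHypergraph

-- The operator is tested on the class indicators of an enumeration of the other vertices of `J f`.
-- Edges at least as large as `J f` contribute only if they have its profile, all with the same
-- positive value; smaller edges contribute equally at x and y by `ih`. Cancelling leaves the two
-- counts.
open scoped Classical in
theorem EdgeClosed.card_eq_of_true_of_mem {X : Type u} {F : Type v} [Fintype X] [Fintype F]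
    {J : F → Set X} {A : Subalgebra ℚ (X → ℚ)} (h : EdgeClosed.{u, v, w} true J A) {x y : X}
    (hxy : cls A x = cls A y) {f : F} (hf : x ∈ J f)
    (ih : ∀ e, (J e).ncard < (J f).ncard →
      (Finset.univ.filter fun e' => x ∈ J e' ∧ profile A (J e') = profile A (J e)).card =
        (Finset.univ.filter fun e' => y ∈ J e' ∧ profile A (J e') = profile A (J e)).card) :
    (Finset.univ.filter fun e => x ∈ J e ∧ profile A (J e) = profile A (J f)).card =
      (Finset.univ.filter fun e => y ∈ J e ∧ profile A (J e) = profile A (J f)).card := by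
  obtain ⟨m, u, hu, hm⟩ : ∃ (m : ℕ) (u : ULift.{w} (Fin m) → X),
      insert x (Set.range u) = J f ∧ m + 1 = (J f).ncard := by
    have e := (Finite.equivFin {z // z ∈ J f ∧ z ≠ x}).symm
    refine ⟨_, fun i => e i.down, ?_, ?_⟩
    · ext z
      constructor
      · rintro (rfl | ⟨i, rfl⟩)
        · exact hf
        · exact (e i.down).2.1
      · intro hz
        by_cases hzx : z = x
        · exact Or.inl hzx
        · exact Or.inr ⟨⟨e.symm ⟨z, hz, hzx⟩⟩, by simp⟩
    · rw [← Set.ncard_sdiff_singleton_add_one hf]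
      rfl
  let g : ULift.{w} (Fin m) → X → ℚ := fun i z => if cls A z = cls A (u i) then 1 else 0
  have hg : ∀ i, g i ∈ A := fun i => indicator_cls_mem A _
  -- A tuple with nonzero weight repeats the classes of u; with z it has `m + 1 = (J f).ncard`
  -- entries, so covering `J e` makes them distinct.
  have hsupp : ∀ z, cls A z = cls A x → ∀ e, (J f).ncard ≤ (J e).ncard →
      tupleSum true (J e) g z ≠ 0 → profile A (J e) = profile A (J f) := by
    intro z hz e hle hne
    obtain ⟨u', _, hu'⟩ := Finset.exists_ne_zero_of_sum_ne_zero hne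
    rw [ite_ne_right_iff] at hu'
    obtain ⟨hcov, hprod⟩ := hu'
    have hcov := hcov.1.antisymm (hcov.2 rfl)
    have hcls : ∀ i, cls A (u' i) = cls A (u i) := fun i => by
      by_contra hi
      exact Finset.prod_ne_zero_iff.1 hprod i (Finset.mem_univ i) (if_neg hi)
    funext c
    rw [profile_eq_of_insert_range hcov (by simp; omega),
      profile_eq_of_insert_range hu (by simp; omega)]
    congr 1
    ext (_ | i)
    · simp [hz]
    · simp [hcls]
  have hpos : 0 < tupleSum true (J f) g x := by
    refine tupleSum_pos hu (fun i z => ?_) fun i => by simp [g]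
    simp only [g]
    split_ifs <;> simp
  have key : ∀ z, cls A z = cls A x → edgeOp true J g z =
      ∑ e ∈ Finset.univ.filter (fun e => z ∈ J e ∧ (J e).ncard < (J f).ncard),
        tupleSum true (J e) g z +
      (Finset.univ.filter fun e => z ∈ J e ∧ profile A (J e) = profile A (J f)).card *
        tupleSum true (J f) g x := by
    intro z hz
    have h1 : ∑ e ∈ Finset.univ.filter (fun e => z ∈ J e ∧ profile A (J e) = profile A (J f)),
        tupleSum true (J e) g z =
        (Finset.univ.filter fun e => z ∈ J e ∧ profile A (J e) = profile A (J f)).card *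
        tupleSum true (J f) g x := by
      rw [← nsmul_eq_mul, ← Finset.sum_const]
      refine Finset.sum_congr rfl fun e he => ?_
      rw [Finset.mem_filter] at he
      exact tupleSum_eq_of_profile_eq true he.2.2 he.2.1 hf hz hg
    rw [← h1, ← Finset.sum_union]
    · refine (Finset.sum_subset (Finset.subset_univ _) fun e _ he => ?_).symm
      by_contra hne
      have hze : z ∈ J e := by_contra fun h' => hne (tupleSum_eq_zero true g h')
      simp only [Finset.mem_union, Finset.mem_filter, Finset.mem_univ, true_and, hze, not_or,
        not_lt] at he
      exact he.2 (hsupp z hz e he.1 hne)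
    · rw [Finset.disjoint_filter]
      rintro e _ ⟨_, hlt⟩ ⟨_, hp⟩
      exact hlt.ne (ncard_eq_of_profile_eq hp)
  have hop := cls_eq_iff.1 hxy _ (h _ g hg)
  rw [key x rfl, key y hxy.symm] at hop
  have hlow : ∑ e ∈ Finset.univ.filter (fun e => x ∈ J e ∧ (J e).ncard < (J f).ncard),
      tupleSum true (J e) g x =
      ∑ e ∈ Finset.univ.filter (fun e => y ∈ J e ∧ (J e).ncard < (J f).ncard),
        tupleSum true (J e) g y := by
    refine Finset.sum_eq_sum_of_card_fiber_eq (fun e => profile A (J e)) _ _ _ _ (fun c => ?_) ?_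
    · by_cases hc : ∃ e, (J e).ncard < (J f).ncard ∧ profile A (J e) = c
      · obtain ⟨e, hlt, rfl⟩ := hc
        have aux : ∀ z, (Finset.univ.filter fun e => z ∈ J e ∧ (J e).ncard < (J f).ncard).filter
            (fun e' => profile A (J e') = profile A (J e)) =
            Finset.univ.filter fun e' => z ∈ J e' ∧ profile A (J e') = profile A (J e) := by
          intro z
          ext e'
          simp only [Finset.mem_filter, Finset.mem_univ, true_and]
          exact ⟨fun h => ⟨h.1.1, h.2⟩,
            fun h => ⟨⟨h.1, (ncard_eq_of_profile_eq h.2).trans_lt hlt⟩, h.2⟩⟩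
        rw [aux, aux]
        exact ih e hlt
      · have aux : ∀ z, (Finset.univ.filter fun e => z ∈ J e ∧ (J e).ncard < (J f).ncard).filter
            (fun e => profile A (J e) = c) = ∅ := by
          intro z
          refine Finset.filter_eq_empty_iff.2 fun e he hec => hc ⟨e, ?_, hec⟩
          exact (Finset.mem_filter.1 he).2.2
        rw [aux, aux]
    · intro e he e' he' hee'
      exact tupleSum_eq_of_profile_eq true hee' (Finset.mem_filter.1 he).2.1
        (Finset.mem_filter.1 he').2.1 hxy hg
  rw [hlow, add_right_inj, mul_left_inj' hpos.ne'] at hop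
  exact_mod_cast hop

theorem EdgeClosed.equitable_of_true {X : Type u} {F : Type v} [Fintype X] [Fintype F]
    {J : F → Set X} {A : Subalgebra ℚ (X → ℚ)} (h : EdgeClosed.{u, v, w} true J A) :
    Equitable J A := by
  classical
  have main : ∀ n, ∀ f, (J f).ncard = n → ∀ x y, cls A x = cls A y →
      (Finset.univ.filter fun e => x ∈ J e ∧ profile A (J e) = profile A (J f)).card =
      (Finset.univ.filter fun e => y ∈ J e ∧ profile A (J e) = profile A (J f)).card := by
    intro n
    induction n using Nat.strong_induction_on with
    | _ n ih =>
      rintro f rfl x y hxy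
      -- The preceding lemma needs an edge of the given profile at its first point; if neither x nor
      -- y has one, both counts vanish.
      have half : ∀ x y, cls A x = cls A y → ∀ e, x ∈ J e → profile A (J e) = profile A (J f) →
          (Finset.univ.filter fun e => x ∈ J e ∧ profile A (J e) = profile A (J f)).card =
          (Finset.univ.filter fun e => y ∈ J e ∧ profile A (J e) = profile A (J f)).card := by
        intro x y hxy e hx he
        rw [← he]
        refine h.card_eq_of_true_of_mem hxy hx fun e' he' => ih _ ?_ e' rfl x y hxy
        rwa [← ncard_eq_of_profile_eq he]
      by_cases hx : ∃ e, x ∈ J e ∧ profile A (J e) = profile A (J f)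
      · obtain ⟨e, h1, h2⟩ := hx
        exact half x y hxy e h1 h2
      by_cases hy : ∃ e, y ∈ J e ∧ profile A (J e) = profile A (J f)
      · obtain ⟨e, h1, h2⟩ := hy
        exact (half y x hxy.symm e h1 h2).symm
      · push Not at hx hy
        rw [Finset.filter_eq_empty_iff.2 fun e _ he => hx e he.1 he.2,
          Finset.filter_eq_empty_iff.2 fun e _ he => hy e he.1 he.2]
  intro x y hxy p
  by_cases hp : ∃ f, profile A (J f) = p
  · obtain ⟨f, rfl⟩ := hp
    convert main _ f rfl x y hxy
  · push Not at hp
    rw [Finset.filter_eq_empty_iff.2 fun e _ he => hp e he.2,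
      Finset.filter_eq_empty_iff.2 fun e _ he => hp e he.2]

/-- Closure under the transfer operators for incidence homomorphisms and for homomorphisms are
equivalent. -/
theorem EdgeClosed.swap {X : Type u} {F : Type v} [Fintype X] [Fintype F]
    {J : F → Set X} {A : Subalgebra ℚ (X → ℚ)} {b : Bool} (h : EdgeClosed.{u, v, w} b J A)
    (b' : Bool) : EdgeClosed.{u, v, w} b' J A := by
  cases b
  · exact h.equitable_of_false.edgeClosed b'
  · exact h.equitable_of_true.edgeClosed b'

end MultiHypergraph

/-! ### Weighted counts and pendant edges -/

theorem Fintype.sum_eq_sum_of_instances {α M : Type*} [AddCommMonoid M] (i j : Fintype α)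
    (f : α → M) : ∑ x ∈ @Finset.univ α i, f x = ∑ x ∈ @Finset.univ α j, f x := by
  rw [Subsingleton.elim i j]

theorem Fintype.sum_sumArrow {V ι X M : Type*} [AddCommMonoid M] {i : Fintype (V ⊕ ι → X)}
    [Fintype (V → X)] [Fintype (ι → X)] (f : (V ⊕ ι → X) → M) :
    ∑ h, f h = ∑ p : V → X, ∑ u : ι → X, f (Sum.elim p u) := by
  rw [← Fintype.sum_prod_type']
  refine Fintype.sum_equiv (Equiv.sumArrowEquivProdArrow V ι X) _ _ fun h => ?_
  exact congrArg f (Sum.elim_comp_inl_inr h).symm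

namespace MultiHypergraph

noncomputable instance fintypeV (G : MultiHypergraph.{u}) : Fintype G.V := Fintype.ofFinite _
noncomputable instance fintypeE (G : MultiHypergraph.{u}) : Fintype G.E := Fintype.ofFinite _

open scoped Classical in
/-- The weighted number of maps from the hypergraph `I` to the hypergraph `J` for which the image
of each edge covers the image edge in the sense of `Cov b`. -/
noncomputable def wcount (b : Bool) {V E X F : Type*} [Fintype V] [Fintype E] [Fintype X]
    [Fintype F] (I : E → Set V) (J : F → Set X) (w : V → X → ℚ) : ℚ :=
  ∑ h : V → X, (∏ v, w v (h v)) * ∏ e, ∑ f, if Cov b (h '' I e) (J f) then 1 else 0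

/-- Once the vertex map is fixed, the edges choose their images independently. -/
theorem wcount_one (b : Bool) {V E X F : Type*} [Fintype V] [Fintype E] [Fintype X]
    [Fintype F] (I : E → Set V) (J : F → Set X) :
    wcount b I J 1 = Nat.card {h : (V → X) × (E → F) // ∀ e, Cov b (h.1 '' I e) (J (h.2 e))} := by
  classical
  let eq : {h : (V → X) × (E → F) // ∀ e, Cov b (h.1 '' I e) (J (h.2 e))} ≃
      (h : V → X) × (∀ e, {f // Cov b (h '' I e) (J f)}) :=
    { toFun := fun h => ⟨h.1.1, fun e => ⟨h.1.2 e, h.2 e⟩⟩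
      invFun := fun h => ⟨(h.1, fun e => (h.2 e).1), fun e => (h.2 e).2⟩
      left_inv := fun _ => rfl
      right_inv := fun _ => rfl }
  rw [Nat.card_congr eq, Nat.card_eq_fintype_card, Fintype.card_sigma]
  push_cast
  refine Finset.sum_congr rfl fun h _ => ?_
  rw [Fintype.card_pi]
  push_cast
  simp only [Pi.one_apply, Finset.prod_const_one, one_mul]
  refine Finset.prod_congr rfl fun e _ => ?_
  rw [Finset.sum_boole, Fintype.card_subtype]

theorem homCount_eq_wcount (B : MultiHypergraph.{u}) (G : MultiHypergraph.{v}) :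
    (homCount B G : ℚ) = wcount true B.inc G.inc 1 := by
  rw [wcount_one, homCount]
  simp [IsHom, Cov, Set.Subset.antisymm_iff]

theorem incHomCount_eq_wcount (B : MultiHypergraph.{u}) (G : MultiHypergraph.{v}) :
    (incHomCount B G : ℚ) = wcount false B.inc G.inc 1 := by
  rw [wcount_one, incHomCount]
  simp [IsIncHom, Cov]

section

variable {V E X F : Type*} [Fintype V] [Fintype E] [Fintype X] [Fintype F]

theorem wcount_congr (b : Bool) {V' E' : Type*} [Fintype V'] [Fintype E'] (α : V' ≃ V)
    (β : E' ≃ E) {I : E → Set V} {I' : E' → Set V'} (hI : ∀ e, I (β e) = α '' I' e)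
    (J : F → Set X) (w : V → X → ℚ) : wcount b I J w = wcount b I' J (fun v => w (α v)) := by
  classical
  refine (Fintype.sum_equiv (α.arrowCongr (Equiv.refl X)) _ _ fun h => ?_).symm
  congr 1
  · exact Fintype.prod_equiv α _ _ fun v => by simp
  · refine Fintype.prod_equiv β _ _ fun e => ?_
    refine Finset.sum_congr rfl fun f _ => ?_
    rw [hI, ← Set.image_comp]
    have : (α.arrowCongr (Equiv.refl X)) h ∘ α = h := by funext v; simp
    rw [this]

theorem wcount_update_add [DecidableEq V] (b : Bool) (I : E → Set V) (J : F → Set X)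
    (w : V → X → ℚ) (v : V) (f g : X → ℚ) :
    wcount b I J (Function.update w v (f + g)) =
      wcount b I J (Function.update w v f) + wcount b I J (Function.update w v g) := by
  rw [wcount, wcount, wcount, ← Finset.sum_add_distrib]
  refine Finset.sum_congr rfl fun h _ => ?_
  rw [← add_mul]
  congr 1
  have : ∀ k : X → ℚ, ∏ z, Function.update w v k z (h z) =
      k (h v) * ∏ z ∈ Finset.univ.erase v, w z (h z) := by
    intro k
    rw [← Finset.mul_prod_erase _ _ (Finset.mem_univ v), Function.update_self]
    congr 1
    exact Finset.prod_congr rfl fun z hz => by rw [Function.update_of_ne (Finset.ne_of_mem_erase hz)]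
  rw [this, this, this, Pi.add_apply, add_mul]

theorem wcount_update_smul [DecidableEq V] (b : Bool) (I : E → Set V) (J : F → Set X)
    (w : V → X → ℚ) (v : V) (c : ℚ) (f : X → ℚ) :
    wcount b I J (Function.update w v (c • f)) = c * wcount b I J (Function.update w v f) := by
  rw [wcount, wcount, Finset.mul_sum]
  refine Finset.sum_congr rfl fun h _ => ?_
  rw [← mul_assoc]
  congr 1
  rw [← Finset.mul_prod_erase _ _ (Finset.mem_univ v),
    ← Finset.mul_prod_erase (Finset.univ : Finset V) _ (Finset.mem_univ v), Function.update_self,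
    Function.update_self, Pi.smul_apply, smul_eq_mul, ← mul_assoc]
  congr 1
  refine Finset.prod_congr rfl fun z hz => ?_
  rw [Function.update_of_ne (Finset.ne_of_mem_erase hz),
    Function.update_of_ne (Finset.ne_of_mem_erase hz)]

/-- The incidence function after attaching at `v` a pendant edge with further vertices `ι`. -/
def attachInc {V E : Type*} (I : E → Set V) (v : V) (ι : Type*) : Option E → Set (V ⊕ ι)
  | none => insert (Sum.inl v) (Set.range Sum.inr)
  | some e => Sum.inl '' I e

-- For a fixed map h on the old vertices, summing over the new vertices and the image of the new
-- edge gives the factor `edgeOp b J g (h v)`.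
open scoped Classical in
theorem wcount_attach (b : Bool) {ι : Type*} [Fintype ι] [i₁ : Fintype (V ⊕ ι)]
    [i₂ : Fintype (Option E)] (I : E → Set V) (v : V) (J : F → Set X) (w : V → X → ℚ)
    (g : ι → X → ℚ) :
    wcount b (attachInc I v ι) J (Sum.elim w g) =
      wcount b I J (Function.update w v (w v * edgeOp b J g)) := by
  obtain rfl : i₁ = instFintypeSum V ι := Subsingleton.elim _ _
  obtain rfl : i₂ = instFintypeOption := Subsingleton.elim _ _
  rw [wcount, Fintype.sum_sumArrow, wcount]
  refine Finset.sum_congr rfl fun h _ => ?_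
  have h1 : ∏ z, Function.update w v (w v * edgeOp b J g) z (h z) =
      (∏ z, w z (h z)) * edgeOp b J g (h v) := by
    rw [← Finset.mul_prod_erase _ _ (Finset.mem_univ v),
      ← Finset.mul_prod_erase (Finset.univ : Finset V) (fun z => w z (h z)) (Finset.mem_univ v),
      Function.update_self, Pi.mul_apply, mul_right_comm]
    congr 2
    refine Finset.prod_congr rfl fun z hz => ?_
    rw [Function.update_of_ne (Finset.ne_of_mem_erase hz)]
  have h2 : edgeOp b J g (h v) = ∑ u : ι → X, (∏ i, g i (u i)) *
      ∑ f, if Cov b (insert (h v) (Set.range u)) (J f) then 1 else 0 := by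
    simp only [edgeOp, tupleSum]
    rw [Finset.sum_comm]
    simp only [Finset.mul_sum, mul_ite, mul_one, mul_zero]
  rw [h1, h2, Finset.mul_sum, Finset.sum_mul]
  refine Finset.sum_congr rfl fun u _ => ?_
  have h3 : Sum.elim h u '' attachInc I v ι none = insert (h v) (Set.range u) := by
    rw [attachInc, Set.image_insert_eq, ← Set.range_comp]; rfl
  have h4 : ∀ e, Sum.elim h u '' attachInc I v ι (some e) = h '' I e := fun e => by
    rw [attachInc, ← Set.image_comp]; rfl
  rw [Fintype.prod_sum_type, Fintype.prod_option]
  simp only [h3, h4, Sum.elim_inl, Sum.elim_inr]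
  ring

/-- The incidence function of the disjoint union of two hypergraphs. -/
def sumInc {X F Y K : Type*} (J : F → Set X) (J' : K → Set Y) : F ⊕ K → Set (X ⊕ Y) :=
  Sum.elim (fun f => Sum.inl '' J f) (fun f => Sum.inr '' J' f)

variable {Y K ι : Type*} [Fintype Y] [Fintype K] [Fintype ι]

theorem edgeOp_sumInc_inl (b : Bool) (J : F → Set X) (J' : K → Set Y) (g : ι → X ⊕ Y → ℚ) :
    edgeOp b (sumInc J J') g ∘ Sum.inl = edgeOp b J (fun i => g i ∘ Sum.inl) := by
  funext x
  simp only [Function.comp_apply, edgeOp, Fintype.sum_sum_type, sumInc, Sum.elim_inl, Sum.elim_inr]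
  rw [Finset.sum_congr rfl fun f _ => tupleSum_image b Sum.inl_injective (J f) g x,
    Finset.sum_eq_zero (s := (Finset.univ : Finset K)) fun f _ => tupleSum_eq_zero b g (by simp),
    add_zero]
  rfl

theorem edgeOp_sumInc_inr (b : Bool) (J : F → Set X) (J' : K → Set Y) (g : ι → X ⊕ Y → ℚ) :
    edgeOp b (sumInc J J') g ∘ Sum.inr = edgeOp b J' (fun i => g i ∘ Sum.inr) := by
  funext x
  simp only [Function.comp_apply, edgeOp, Fintype.sum_sum_type, sumInc, Sum.elim_inl, Sum.elim_inr]
  rw [Finset.sum_congr rfl fun f _ => tupleSum_image b Sum.inr_injective (J' f) g x,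
    Finset.sum_eq_zero (s := (Finset.univ : Finset F)) fun f _ => tupleSum_eq_zero b g (by simp),
    zero_add]
  rfl

end

end MultiHypergraph

/-! ### Incidence trees: attaching and peeling pendant edges -/

/-- Parents in a rooted tree are unique: a neighbour of x closer to r is the penultimate vertex of
the path from r to x. -/
theorem SimpleGraph.IsTree.eq_of_adj_of_dist {V : Type*} {T : SimpleGraph V} (hT : T.IsTree)
    {r x y z : V} (hy : T.Adj x y) (hz : T.Adj x z) (hry : T.dist r x = T.dist r y + 1)
    (hrz : T.dist r x = T.dist r z + 1) : y = z := by
  classical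
  obtain ⟨p, hp, -⟩ := (hT.connected r x).exists_path_of_dist
  have key : ∀ y, T.Adj x y → T.dist r x = T.dist r y + 1 → y = p.penultimate := by
    intro y hy hry
    obtain ⟨q, hq, hq'⟩ := (hT.connected r y).exists_path_of_dist
    refine hT.isAcyclic.eq_penultimate_of_adj_end hp hy ?_
    refine hT.isAcyclic.mem_support_of_ne_mem_support_of_adj_of_isPath hp hq hy fun hx => ?_
    have h1 := T.dist_le (q.takeUntil x hx)
    have h2 := q.length_takeUntil_le_length hx
    omega
  rw [key y hy hry, key z hz hrz]

theorem SimpleGraph.Connected.exists_adj_dist {V : Type*} {T : SimpleGraph V} (hT : T.Connected)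
    {r x : V} (hx : x ≠ r) : ∃ y, T.Adj x y ∧ T.dist r x = T.dist r y + 1 := by
  obtain ⟨p, -, hp⟩ := (hT x r).exists_path_of_dist
  cases p with
  | nil => exact absurd rfl hx
  | @cons _ y _ h q =>
    refine ⟨y, h, ?_⟩
    have h1 := T.dist_le q
    have h2 : T.dist r x ≤ T.dist r y + 1 := by
      have := hT.dist_triangle (u := r) (v := y) (w := x)
      rwa [SimpleGraph.dist_eq_one_iff_adj.2 h.symm] at this
    rw [SimpleGraph.Walk.length_cons, T.dist_comm] at hp
    rw [T.dist_comm] at h1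
    omega

namespace MultiHypergraph

@[simp] theorem incidenceGraph_not_adj_inl_inl {G : MultiHypergraph.{u}} {x y : G.V} :
    ¬ G.incidenceGraph.Adj (.inl x) (.inl y) := id

@[simp] theorem incidenceGraph_not_adj_inr_inr {G : MultiHypergraph.{u}} {e f : G.E} :
    ¬ G.incidenceGraph.Adj (.inr e) (.inr f) := id

theorem mem_connectedBergeAcyclic_iff {B : MultiHypergraph.{u}} :
    B ∈ connectedBergeAcyclic ↔ B.incidenceGraph.IsTree :=
  ⟨fun h => ⟨h.1, h.2⟩, fun h => ⟨h.1, h.2⟩⟩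

/-- The hypergraph with one vertex and no edges. -/
def point : MultiHypergraph.{u} where
  V := PUnit
  E := PEmpty
  inc e := e.elim
  inc_nonempty e := e.elim

theorem point_mem : point.{u} ∈ connectedBergeAcyclic := by
  rw [mem_connectedBergeAcyclic_iff]
  have : Nonempty (point.{u}.V ⊕ point.{u}.E) := ⟨.inl PUnit.unit⟩
  have : Subsingleton point.{u}.V := inferInstanceAs (Subsingleton PUnit)
  have : IsEmpty point.{u}.E := inferInstanceAs (IsEmpty PEmpty)
  have : Subsingleton (point.{u}.V ⊕ point.{u}.E) := (Equiv.sumEmpty _ _).subsingleton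
  exact .of_subsingleton

/-- Attach a pendant edge at the vertex `v` whose further vertices are new and indexed by `ι`. -/
def attach (B : MultiHypergraph.{u}) (v : B.V) (ι : Type u) [Finite ι] : MultiHypergraph.{u} where
  V := B.V ⊕ ι
  E := Option B.E
  inc := attachInc B.inc v ι
  inc_nonempty
    | none => ⟨_, Set.mem_insert _ _⟩
    | some e => (B.inc_nonempty e).image _

/-- The edges of the incidence graph are the incident pairs. -/
noncomputable def edgeSetEquiv (G : MultiHypergraph.{u}) :
    (Σ e : G.E, G.inc e) ≃ G.incidenceGraph.edgeSet :=
  Equiv.ofBijective (fun p => ⟨s(.inl p.2.1, .inr p.1), p.2.2⟩) <| by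
    constructor
    · rintro ⟨e, x, hx⟩ ⟨f, y, hy⟩ h
      replace h := congrArg Subtype.val h
      simp only [Sym2.eq_iff, Sum.inl.injEq, Sum.inr.injEq, reduceCtorEq,
        and_self, or_false] at h
      obtain ⟨rfl, rfl⟩ := h
      rfl
    · rintro ⟨p, hp⟩
      induction p with
      | _ a b =>
        rcases a with x | e <;> rcases b with y | f
        · exact False.elim hp
        · exact ⟨⟨f, x, hp⟩, rfl⟩
        · exact ⟨⟨e, y, hp⟩, Subtype.ext Sym2.eq_swap⟩
        · exact False.elim hp

theorem card_edgeSet_incidenceGraph (G : MultiHypergraph.{u}) :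
    Nat.card G.incidenceGraph.edgeSet = ∑ e, (G.inc e).ncard := by
  rw [← Nat.card_congr G.edgeSetEquiv, Nat.card_sigma]
  rfl

theorem card_edgeSet_attach (B : MultiHypergraph.{u}) (v : B.V) (ι : Type u) [Finite ι] :
    Nat.card (B.attach v ι).incidenceGraph.edgeSet =
      Nat.card B.incidenceGraph.edgeSet + (Nat.card ι + 1) := by
  rw [card_edgeSet_incidenceGraph, card_edgeSet_incidenceGraph]
  have : ∑ e : (B.attach v ι).E, ((B.attach v ι).inc e).ncard =
      ∑ e : Option B.E, (attachInc B.inc v ι e).ncard :=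
    Fintype.sum_eq_sum_of_instances (α := Option B.E) _ _ fun e => (attachInc B.inc v ι e).ncard
  rw [this, Fintype.sum_option, add_comm]
  congr 1
  · exact Finset.sum_congr rfl fun e _ => Set.ncard_image_of_injective _ Sum.inl_injective
  · rw [attachInc, Set.ncard_insert_of_notMem (by simp), ← Set.image_univ,
      Set.ncard_image_of_injective _ Sum.inr_injective, Set.ncard_univ]

/-- A connected graph is a tree if it has one more vertex than edges, and attaching adds `Nat.card ι
+ 1` to both numbers in the incidence graph. -/
theorem attach_mem {B : MultiHypergraph.{u}} (hB : B ∈ connectedBergeAcyclic) (v : B.V)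
    (ι : Type u) [Finite ι] : B.attach v ι ∈ connectedBergeAcyclic := by
  rw [mem_connectedBergeAcyclic_iff] at hB ⊢
  rw [SimpleGraph.isTree_iff_connected_and_card] at hB ⊢
  refine ⟨?_, ?_⟩
  · let φ : B.incidenceGraph →g (B.attach v ι).incidenceGraph :=
      { toFun := Sum.map Sum.inl some
        map_rel' := by
          rintro (x | e) (y | f) h
          · exact h
          · exact Set.mem_image_of_mem _ h
          · exact Set.mem_image_of_mem _ h
          · exact h }
    have hnone : ∀ x ∈ attachInc B.inc v ι none,
        (B.attach v ι).incidenceGraph.Reachable (.inl x) (.inr none) := fun x hx =>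
      SimpleGraph.Adj.reachable (G := (B.attach v ι).incidenceGraph) hx
    rw [SimpleGraph.connected_iff_exists_forall_reachable]
    refine ⟨.inl (.inl v), ?_⟩
    have hold : ∀ a, (B.attach v ι).incidenceGraph.Reachable (.inl (.inl v)) (φ a) := fun a =>
      (hB.1 (.inl v) a).map φ
    rintro ((x | i) | (_ | e))
    · exact hold (.inl x)
    · exact (hnone _ (Set.mem_insert _ _)).trans
        (hnone _ (Set.mem_insert_of_mem _ ⟨i, rfl⟩)).symm
    · exact hnone _ (Set.mem_insert _ _)
    · exact hold (.inr e)
  · have h1 : Nat.card ((B.attach v ι).V ⊕ (B.attach v ι).E) =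
        Nat.card (B.V ⊕ B.E) + (Nat.card ι + 1) := by
      rw [Nat.card_sum, Nat.card_sum]
      change Nat.card (B.V ⊕ ι) + Nat.card (Option B.E) = _
      rw [Nat.card_sum, Finite.card_option]
      ring
    rw [h1, card_edgeSet_attach, ← hB.2]
    ring

/-- Every connected Berge-acyclic hypergraph with an edge arises by attaching a pendant edge. -/
theorem exists_eq_attach {B : MultiHypergraph.{u}} (hB : B ∈ connectedBergeAcyclic)
    [Nonempty B.E] : ∃ B' ∈ connectedBergeAcyclic.{u}, ∃ (v : B'.V) (ι : Type u) (_ : Finite ι)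
      (α : B'.V ⊕ ι ≃ B.V) (β : Option B'.E ≃ B.E),
      ∀ e, B.inc (β e) = α '' attachInc B'.inc v ι e := by
  classical
  rw [mem_connectedBergeAcyclic_iff] at hB
  set T := B.incidenceGraph with hTdef
  obtain ⟨r₀, -⟩ := B.inc_nonempty (Classical.arbitrary B.E)
  let d : B.V ⊕ B.E → ℕ := T.dist (.inl r₀)
  -- A hyperedge farthest from the root `r₀` is pendant: apart from its parent r, its vertices lie
  -- in no other hyperedge.
  obtain ⟨e₀, hmax⟩ := Finite.exists_max (fun e : B.E => d (.inr e))
  obtain ⟨r, hr, hdr⟩ : ∃ r, r ∈ B.inc e₀ ∧ d (.inr e₀) = d (.inl r) + 1 := by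
    obtain ⟨y, hy, hd⟩ := hB.connected.exists_adj_dist (r := .inl r₀) (x := .inr e₀) (by simp)
    rcases y with r | f
    · exact ⟨r, hy, hd⟩
    · exact (incidenceGraph_not_adj_inr_inr hy).elim
  have hpriv : ∀ x ∈ B.inc e₀, x ≠ r → d (.inl x) = d (.inr e₀) + 1 := by
    intro x hx hxr
    refine (hB.dist_eq_dist_add_one_of_adj (.inl r₀)
      (show T.Adj (.inl x) (.inr e₀) from hx)).resolve_right fun h => hxr ?_
    exact Sum.inl_injective (hB.eq_of_adj_of_dist (r := .inl r₀) (x := .inr e₀)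
      (show T.Adj (.inr e₀) (.inl x) from hx) hr h hdr)
  have honly : ∀ x ∈ B.inc e₀, x ≠ r → ∀ f, x ∈ B.inc f → f = e₀ := by
    intro x hx hxr f hf
    have h1 := hpriv x hx hxr
    -- Either f is also the parent of x, hence equal to `e₀`, or f is farther from the root than
    -- `e₀`.
    rcases hB.dist_eq_dist_add_one_of_adj (.inl r₀)
      (show T.Adj (.inl x) (.inr f) from hf) with h | h
    · exact Sum.inr_injective (hB.eq_of_adj_of_dist (r := .inl r₀)
        (show T.Adj (.inl x) (.inr f) from hf) hx h h1)
    · have := hmax f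
      simp only [d] at this h1
      omega
  let P : B.V → Prop := fun x => x ∈ B.inc e₀ → x = r
  let B' : MultiHypergraph.{u} :=
    { V := {x // P x}
      E := {e // e ≠ e₀}
      inc := fun e => Subtype.val ⁻¹' B.inc e
      inc_nonempty := fun e => by
        obtain ⟨x, hx⟩ := B.inc_nonempty e
        exact ⟨⟨x, fun h => by_contra fun hxr => e.2 (honly x h hxr _ hx)⟩, hx⟩ }
  let φ : B'.incidenceGraph →g T :=
    { toFun := Sum.map Subtype.val Subtype.val
      map_rel' := by rintro (x | e) (y | f) h <;> exact h }
  have hφ : Function.Injective φ :=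
    Sum.map_injective.2 ⟨Subtype.val_injective, Subtype.val_injective⟩
  have hr₀ : P r₀ := fun h => by
    by_contra hne
    have := hpriv r₀ h hne
    simp [d] at this
  have hconn : B'.incidenceGraph.Connected := by
    rw [SimpleGraph.connected_iff_exists_forall_reachable]
    refine ⟨.inl ⟨r₀, hr₀⟩, ?_⟩
    -- Induction on the distance to the root: the parent of a surviving node survives.
    have : ∀ n, ∀ a, d (φ a) = n → B'.incidenceGraph.Reachable (.inl ⟨r₀, hr₀⟩) a := by
      intro n
      induction n with
      | zero =>
        intro a ha
        have : Sum.inl r₀ = φ a := (hB.connected.dist_eq_zero_iff).1 ha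
        obtain rfl : Sum.inl ⟨r₀, hr₀⟩ = a := hφ this
        rfl
      | succ n ih =>
        intro a ha
        have hne : φ a ≠ .inl r₀ := fun h => by
          rw [h] at ha
          simp [d] at ha
        obtain ⟨y, hy, hd⟩ := hB.connected.exists_adj_dist hne
        have hdy : d y = n := by
          simp only [d] at ha ⊢
          omega
        obtain ⟨c, rfl, hc⟩ : ∃ c, φ c = y ∧ B'.incidenceGraph.Adj c a := by
          rcases a with ⟨x, hx⟩ | ⟨f, hf⟩ <;> rcases y with y | g
          · exact (incidenceGraph_not_adj_inl_inl hy).elim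
          · have hg : g ≠ e₀ := by
              rintro rfl
              obtain rfl := hx hy
              simp only [d] at ha hdy hdr
              change T.dist _ (Sum.inl x) = _ at ha
              omega
            exact ⟨.inr ⟨g, hg⟩, rfl, hy⟩
          · refine ⟨.inl ⟨y, fun hye => ?_⟩, rfl, hy⟩
            by_contra hyr
            exact hf (honly y hye hyr f hy)
          · exact (incidenceGraph_not_adj_inr_inr hy).elim
        exact (ih c hdy).trans hc.reachable
    exact fun a => this _ a rfl
  refine ⟨B', mem_connectedBergeAcyclic_iff.2 ⟨hconn, hB.isAcyclic.comap φ hφ⟩, ⟨r, fun _ => rfl⟩,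
    {x // ¬ P x}, inferInstance, Equiv.sumCompl P, Equiv.optionSubtypeNe e₀, ?_⟩
  have hp : ∀ x : {x // ¬ P x}, x.1 ∈ B.inc e₀ ∧ x.1 ≠ r := fun x => by
    simpa only [P, Classical.not_imp] using x.2
  rintro (_ | e)
  · ext x
    simp only [attachInc, Set.image_insert_eq, ← Set.range_comp]
    constructor
    · intro hx
      by_cases hxr : x = r
      · exact Or.inl hxr
      · exact Or.inr ⟨⟨x, fun h => hxr (h hx)⟩, rfl⟩
    · rintro (rfl | ⟨y, rfl⟩)
      · exact hr
      · exact (hp y).1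
  · ext x
    simp only [attachInc, ← Set.image_comp]
    constructor
    · intro hx
      exact ⟨⟨x, fun h => by_contra fun hxr => e.2 (honly x h hxr _ hx)⟩, hx, rfl⟩
    · rintro ⟨y, hy, rfl⟩
      exact hy

theorem subsingleton_of_isEmpty {B : MultiHypergraph.{u}} (hB : B ∈ connectedBergeAcyclic)
    [IsEmpty B.E] : Nonempty (Unique B.V) := by
  have h0 : B.incidenceGraph = ⊥ := by
    ext (x | e) (y | f)
    · simp
    · exact isEmptyElim f
    · exact isEmptyElim e
    · exact isEmptyElim e
  have hc : B.incidenceGraph.Connected := hB.1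
  obtain ⟨x | e⟩ := hc.nonempty
  · refine ⟨⟨⟨x⟩, fun y => ?_⟩⟩
    have := hc (.inl y) (.inl x)
    rw [h0, SimpleGraph.reachable_bot] at this
    exact Sum.inl_injective this
  · exact isEmptyElim e

end MultiHypergraph

/-! ### The generated algebra and the transfer between the two counts -/

namespace MultiHypergraph

/-- The functions obtained from `1` by multiplication with transfer operators and by linear
combinations, with a measure of the number of steps. -/
inductive Generated (b : Bool) {X : Type u} {F : Type v} [Fintype X] [Fintype F]
    (J : F → Set X) : ℕ → (X → ℚ) → Prop
  | one : Generated b J 0 1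
  | mul_edgeOp (ι : Type w) [Fintype ι] (n : ℕ) (f : X → ℚ) (m : ι → ℕ) (g : ι → X → ℚ) :
      Generated b J n f → (∀ i, Generated b J (m i) (g i)) →
      Generated b J (n + ∑ i, m i + 1) (f * edgeOp b J g)
  | add (n m : ℕ) (f g : X → ℚ) : Generated b J n f → Generated b J m g →
      Generated b J (n + m + 1) (f + g)
  | smul (n : ℕ) (c : ℚ) (f : X → ℚ) : Generated b J n f → Generated b J (n + 1) (c • f)

section

variable {X : Type u} {F : Type v} [Fintype X] [Fintype F] {b : Bool} {J : F → Set X}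

/-- Only multiplication by a single operator is a generating step, to match attaching one pendant
edge; general products follow by induction on the second factor. -/
theorem Generated.mul {n m : ℕ} {f g : X → ℚ} (hf : Generated.{u, v, w} b J n f)
    (hg : Generated.{u, v, w} b J m g) : ∃ k, Generated.{u, v, w} b J k (f * g) := by
  induction hg with
  | one => exact ⟨n, by rwa [mul_one]⟩
  | mul_edgeOp ι m g k h _ hh ih _ =>
    obtain ⟨l, hl⟩ := ih
    exact ⟨_, by rw [← mul_assoc]; exact .mul_edgeOp ι l _ k h hl hh⟩
  | add m k g h _ _ ihg ihh =>
    obtain ⟨l, hl⟩ := ihg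
    obtain ⟨l', hl'⟩ := ihh
    exact ⟨_, by rw [mul_add]; exact .add _ _ _ _ hl hl'⟩
  | smul m c g _ ih =>
    obtain ⟨l, hl⟩ := ih
    exact ⟨_, by rw [mul_smul_comm]; exact .smul _ c _ hl⟩

variable (b J) in
/-- The least subalgebra closed under the transfer operators. -/
def generatedSubalgebra : Subalgebra ℚ (X → ℚ) where
  carrier := {f | ∃ n, Generated.{u, v, w} b J n f}
  mul_mem' := fun ⟨_, hf⟩ ⟨_, hg⟩ => hf.mul hg
  add_mem' := fun ⟨_, hf⟩ ⟨_, hg⟩ => ⟨_, .add _ _ _ _ hf hg⟩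
  algebraMap_mem' c := ⟨_, by
    rw [Algebra.algebraMap_eq_smul_one]
    exact .smul 0 c 1 .one⟩

theorem edgeClosed_generatedSubalgebra :
    EdgeClosed.{u, v, w} b J (generatedSubalgebra.{u, v, w} b J) := by
  intro ι _ g hg
  choose m hm using hg
  exact ⟨_, by rw [← one_mul (edgeOp b J g)]; exact .mul_edgeOp ι 0 1 m g .one hm⟩

end

theorem comp_update {V X Y : Type*} [DecidableEq V] (w : V → Y → ℚ) (v : V) (f : Y → ℚ)
    (i : X → Y) : (fun z => Function.update w v f z ∘ i) =
      Function.update (fun z => w z ∘ i) v (f ∘ i) := by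
  funext z
  by_cases h : z = v
  · subst h; simp
  · simp [h]

theorem comp_elim {V ι X Y : Type*} (w : V → Y → ℚ) (g : ι → Y → ℚ)
    (i : X → Y) : (fun z => Sum.elim w g z ∘ i) =
      Sum.elim (fun z => w z ∘ i) (fun z => g z ∘ i) := by
  funext z
  cases z <;> rfl

section

variable {G : MultiHypergraph.{u}} {H : MultiHypergraph.{v}} {b : Bool}

open scoped Classical in
/-- Attaching a pendant edge has the same effect on weighted counts in both summands. -/
theorem wcount_attach_sum (B : MultiHypergraph.{w}) (z : B.V) (ι : Type w) [Fintype ι]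
    (w : B.V → G.V ⊕ H.V → ℚ) (g : ι → G.V ⊕ H.V → ℚ) :
    wcount b (B.attach z ι).inc G.inc (fun y => Sum.elim w g y ∘ Sum.inl) =
        wcount b B.inc G.inc (fun y => Function.update w z
          (w z * edgeOp b (sumInc G.inc H.inc) g) y ∘ Sum.inl) ∧
      wcount b (B.attach z ι).inc H.inc (fun y => Sum.elim w g y ∘ Sum.inr) =
        wcount b B.inc H.inc (fun y => Function.update w z
          (w z * edgeOp b (sumInc G.inc H.inc) g) y ∘ Sum.inr) := by
  rw [comp_update, comp_update, Pi.mul_comp, Pi.mul_comp, edgeOp_sumInc_inl, edgeOp_sumInc_inr]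
  exact ⟨(congrArg (wcount b (B.attach z ι).inc G.inc) (comp_elim w g Sum.inl)).trans
      (wcount_attach (i₁ := (B.attach z ι).fintypeV) (i₂ := (B.attach z ι).fintypeE) ..),
    (congrArg (wcount b (B.attach z ι).inc H.inc) (comp_elim w g Sum.inr)).trans
      (wcount_attach (i₁ := (B.attach z ι).fintypeV) (i₂ := (B.attach z ι).fintypeE) ..)⟩

/-- Equality of all counts of connected Berge-acyclic hypergraphs extends to weighted counts with
generated weights. -/
theorem wcount_eq_of_generated
    (h : ∀ B ∈ connectedBergeAcyclic.{w}, wcount b B.inc G.inc 1 = wcount b B.inc H.inc 1) :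
    ∀ (N : ℕ), ∀ B ∈ connectedBergeAcyclic.{w}, ∀ (w : B.V → G.V ⊕ H.V → ℚ) (n : B.V → ℕ),
      (∀ z, Generated.{max u v, max u v, w} b (sumInc G.inc H.inc) (n z) (w z)) → ∑ z, n z = N →
      wcount b B.inc G.inc (fun z => w z ∘ Sum.inl) =
        wcount b B.inc H.inc (fun z => w z ∘ Sum.inr) := by
  classical
  intro N
  induction N using Nat.strong_induction_on with
  | _ N ih =>
  intro B hB w n hw hN
  have step : ∀ (z : B.V) (k : ℕ) (f : G.V ⊕ H.V → ℚ), k < n z →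
      Generated.{max u v, max u v, w} b (sumInc G.inc H.inc) k f →
      wcount b B.inc G.inc (fun y => Function.update w z f y ∘ Sum.inl) =
        wcount b B.inc H.inc (fun y => Function.update w z f y ∘ Sum.inr) := by
    intro z k f hk hf
    refine ih (∑ y, Function.update n z k y) ?_ B hB _ (Function.update n z k) (fun y => ?_) rfl
    · rw [← hN]
      refine Finset.sum_lt_sum (fun y _ => ?_) ⟨z, Finset.mem_univ _, by simpa⟩
      by_cases hy : y = z
      · subst hy; simpa using hk.le
      · simp [hy]
    · by_cases hy : y = z
      · subst hy; simpa using hf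
      · simpa [hy] using hw y
  -- Undo the last generating step of the weight at some z. An operator factor becomes a pendant
  -- edge whose new vertices carry the weights `g i`, which lowers the total measure by one; sums
  -- and multiples are split by multilinearity. If all measures vanish, all weights are 1.
  by_cases hn : ∃ z, n z ≠ 0
  · obtain ⟨z, hz⟩ := hn
    have hgen := hw z
    have hself := Function.update_eq_self z w
    generalize hk : n z = k at hgen hz
    generalize w z = f at hgen hself
    rw [← hself]
    cases hgen with
    | one => exact absurd rfl hz
    | mul_edgeOp ι m f l g hf hg =>
      have h1 := wcount_attach_sum (G := G) (H := H) (b := b) B z ι (Function.update w z f) g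
      simp only [Function.update_self, Function.update_idem] at h1
      rw [← h1.1, ← h1.2]
      refine ih (∑ y, Function.update n z m y + ∑ i, l i) ?_ _ (attach_mem hB z ι) _
        (Sum.elim (Function.update n z m) l) ?_ ?_
      · have he : ∑ y ∈ Finset.univ.erase z, Function.update n z m y =
            ∑ y ∈ Finset.univ.erase z, n y :=
          Finset.sum_congr rfl fun y hy => Function.update_of_ne (Finset.ne_of_mem_erase hy) m n
        have h2 := Finset.add_sum_erase Finset.univ (Function.update n z m) (Finset.mem_univ z)
        have h3 := Finset.add_sum_erase Finset.univ n (Finset.mem_univ z)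
        rw [he, Function.update_self] at h2
        omega
      · rintro (y | i)
        · by_cases hy : y = z
          · subst hy; simpa using hf
          · simpa [hy] using hw y
        · exact hg i
      · exact (Fintype.sum_eq_sum_of_instances (α := B.V ⊕ ι) _ _ _).trans (Fintype.sum_sum_type _)
    | add m l f g hf hg =>
      have h1 := step z m f (by omega) hf
      have h2 := step z l g (by omega) hg
      rw [comp_update, comp_update] at h1 h2 ⊢
      rw [Pi.add_comp, Pi.add_comp, wcount_update_add, wcount_update_add, h1, h2]
    | smul m c f hf =>
      have h1 := step z m f (by omega) hf
      rw [comp_update, comp_update] at h1 ⊢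
      rw [Pi.smul_comp, Pi.smul_comp, wcount_update_smul, wcount_update_smul, h1]
  · push Not at hn
    have hw1 : ∀ z, w z = 1 := by
      intro z
      have hgen := hw z
      rw [hn z] at hgen
      generalize w z = f at hgen
      cases hgen
      rfl
    obtain rfl : w = 1 := funext hw1
    exact h B hB

theorem wcount_of_isEmpty {V E X F : Type*} [Fintype V] [Fintype E] [Fintype X] [Fintype F]
    [Unique V] [IsEmpty E] (I : E → Set V) (J : F → Set X) (w : V → X → ℚ) :
    wcount b I J w = ∑ x, w default x := by
  classical
  rw [wcount]
  refine (Fintype.sum_eq_sum_of_instances _ _ _).trans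
    (Fintype.sum_equiv (Equiv.funUnique V X) _ (fun x => w default x) fun h => ?_)
  simp

/-- Apply the weighted equality to the one-vertex hypergraph with weight f. -/
theorem sum_eq_of_mem_generatedSubalgebra
    (h : ∀ B ∈ connectedBergeAcyclic.{w}, wcount b B.inc G.inc 1 = wcount b B.inc H.inc 1)
    {f : G.V ⊕ H.V → ℚ}
    (hf : f ∈ generatedSubalgebra.{max u v, max u v, w} b (sumInc G.inc H.inc)) :
    ∑ x, f (Sum.inl x) = ∑ x, f (Sum.inr x) := by
  obtain ⟨n, hn⟩ := hf
  have key := wcount_eq_of_generated h _ point point_mem (fun _ => f) (fun _ => n) (fun _ => hn) rfl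
  have : Unique point.{w}.V := inferInstanceAs (Unique PUnit)
  have : IsEmpty point.{w}.E := inferInstanceAs (IsEmpty PEmpty)
  simpa [wcount_of_isEmpty] using key

/-- If the sums of the functions in a closed algebra over both summands agree, so do all weighted
counts with weights in the algebra. -/
theorem wcount_eq_of_edgeClosed {A : Subalgebra ℚ (G.V ⊕ H.V → ℚ)}
    (hA : EdgeClosed.{max u v, max u v, w} b (sumInc G.inc H.inc) A)
    (hsum : ∀ f ∈ A, ∑ x, f (Sum.inl x) = ∑ x, f (Sum.inr x)) :
    ∀ (N : ℕ), ∀ B ∈ connectedBergeAcyclic.{w}, Nat.card B.E = N →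
      ∀ (w : B.V → G.V ⊕ H.V → ℚ), (∀ z, w z ∈ A) →
      wcount b B.inc G.inc (fun z => w z ∘ Sum.inl) =
        wcount b B.inc H.inc (fun z => w z ∘ Sum.inr) := by
  classical
  intro N
  induction N with
  | zero =>
    intro B hB hN w hw
    have : IsEmpty B.E := Finite.card_eq_zero_iff.1 hN
    obtain ⟨_⟩ := subsingleton_of_isEmpty hB
    rw [wcount_of_isEmpty, wcount_of_isEmpty]
    exact hsum _ (hw _)
  | succ N ih =>
    intro B hB hN w hw
    have : Nonempty B.E := (Nat.card_pos_iff.1 (by omega)).1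
    -- Peeling off a pendant edge multiplies the weight at z by a transfer operator, which stays in
    -- `A` by closure.
    obtain ⟨B', hB', z, ι, _, α, β, hαβ⟩ := exists_eq_attach hB
    have := Fintype.ofFinite ι
    have hcard : Nat.card B'.E = N := by
      rw [← Nat.card_congr β, Finite.card_option] at hN
      omega
    have heq : (fun y => w (α y)) = Sum.elim (fun y => w (α (.inl y))) (fun i => w (α (.inr i))) := by
      funext y
      cases y <;> rfl
    have h1 := wcount_attach_sum (G := G) (H := H) (b := b) B' z ι (fun y => w (α (.inl y)))
      (fun i => w (α (.inr i)))
    rw [← heq] at h1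
    have hG := wcount_congr (V' := (B'.attach z ι).V) (E' := (B'.attach z ι).E) b α β
      (I' := (B'.attach z ι).inc) hαβ G.inc (fun y => w y ∘ Sum.inl)
    have hH := wcount_congr (V' := (B'.attach z ι).V) (E' := (B'.attach z ι).E) b α β
      (I' := (B'.attach z ι).inc) hαβ H.inc (fun y => w y ∘ Sum.inr)
    rw [hG, hH]
    refine h1.1.trans (Eq.trans ?_ h1.2.symm)
    refine ih B' hB' hcard _ fun y => ?_
    by_cases hy : y = z
    · subst hy
      rw [Function.update_self]
      exact A.mul_mem (hw _) (hA ι _ fun i => hw _)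
    · rw [Function.update_of_ne hy]
      exact hw _

/-- The algebra generated by the operators of type `b` has equal sums on both sides and, by
`EdgeClosed.swap`, is closed under those of type `b'`; hence it contains all weights that arise when
type `b'` counts are peeled. -/
theorem wcount_eq_swap (b' : Bool)
    (h : ∀ B ∈ connectedBergeAcyclic.{w}, wcount b B.inc G.inc 1 = wcount b B.inc H.inc 1)
    (B : MultiHypergraph.{w}) (hB : B ∈ connectedBergeAcyclic) :
    wcount b' B.inc G.inc 1 = wcount b' B.inc H.inc 1 :=
  wcount_eq_of_edgeClosed (edgeClosed_generatedSubalgebra.{max u v, max u v, w}.swap b')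
    (fun _ hf => sum_eq_of_mem_generatedSubalgebra h hf) _ B hB rfl (fun _ => 1)
    fun _ => Subalgebra.one_mem _

end

end MultiHypergraph

theorem mainTheorem4 (G : MultiHypergraph.{u}) (H : MultiHypergraph.{v}) :
    MultiHypergraph.incHomVector MultiHypergraph.connectedBergeAcyclic.{w} G =
        MultiHypergraph.incHomVector MultiHypergraph.connectedBergeAcyclic.{w} H ↔
      MultiHypergraph.homVector MultiHypergraph.connectedBergeAcyclic.{w} G =
        MultiHypergraph.homVector MultiHypergraph.connectedBergeAcyclic.{w} H := by
  constructor
  · intro h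
    funext B
    have := MultiHypergraph.wcount_eq_swap (G := G) (H := H) (b := false) true (fun B hB => by
      rw [← MultiHypergraph.incHomCount_eq_wcount, ← MultiHypergraph.incHomCount_eq_wcount]
      exact congrArg _ (congrFun h ⟨B, hB⟩)) B.1 B.2
    rw [← MultiHypergraph.homCount_eq_wcount, ← MultiHypergraph.homCount_eq_wcount] at this
    exact_mod_cast this
  · intro h
    funext B
    have := MultiHypergraph.wcount_eq_swap (G := G) (H := H) (b := true) false (fun B hB => by
      rw [← MultiHypergraph.homCount_eq_wcount, ← MultiHypergraph.homCount_eq_wcount]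
      exact congrArg _ (congrFun h ⟨B, hB⟩)) B.1 B.2
    rw [← MultiHypergraph.incHomCount_eq_wcount, ← MultiHypergraph.incHomCount_eq_wcount] at this
    exact_mod_cast this
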